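/- Let $L$ be the first-order language with one binary function symbol $f$ and one constant symbol $c$. The empty $L$-theory has a model completion. Let $T$ be any model completion of the empty $L$-theory. For subsets $A,B,C$ of a model of $T$, write $A\mathop{\perp\!\!\!\perp}_C B$ if $A\cap B\subseteq C$ and $f(a,b)=f(b,a)=c$ for all $a\in A\setminus C$ and $b\in B\setminus C$. ($T$ does not decide, for instance, whether $f(c,c)=c$, so it is not complete; the statements below hold in a monster model of each completion $T'$ of $T$.) 1. $\mathop{\perp\!\!\!\perp}$ is a free amalgamation relation in Conant's sense, that is, for all small sets $A,B,C,D$ and tuples $a,a'$ in a monster model (with $XY$ denoting $X\cup Y$, a tuple being identified with the set of its entries where a set is called for, and algebraically closed meaning equal to one's model-theoretic algebraic closure $\mathrm{acl}$): - Invariance: whether $A\mathop{\perp\!\!\!\perp}_C B$ holds depends only on the type of $ABC$. - Monotonicity: if $A\mathop{\perp\!\!\!\perp}_C B$, $A_0\subseteq A$ and $B_0\subseteq B$, then $A_0\mathop{\perp\!\!\!\perp}_C B_0$. - Full transitivity: if $D\subseteq C\subseteq B$, then $A\mathop{\perp\!\!\!\perp}_D B$ if and only if $A\mathop{\perp\!\!\!\perp}_D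 C$ and $A\mathop{\perp\!\!\!\perp}_C B$. - Full existence: if $C$ is algebraically closed, then for all $a,B$ there is $a'\equiv_C a$ with $a'\mathop{\perp\!\!\!\perp}_C B$. - Stationarity: if $a,B,C$ are algebraically closed, $C\subseteq a\cap B$, $a'\equiv_C a$, $a\mathop{\perp\!\!\!\perp}_C B$ and $a'\mathop{\perp\!\!\!\perp}_C B$, then $a'\equiv_B a$. - Freedom: if $A\mathop{\perp\!\!\!\perp}_C B$ and $C\cap AB\subseteq D\subseteq C$, then $A\mathop{\perp\!\!\!\perp}_D B$. - Closure: if $A,B,C$ are algebraically closed, $C\subseteq A\cap B$ and $A\mathop{\perp\!\!\!\perp}_C B$, then $AB$ is algebraically closed. Hence every completion $T'$ of $T$ is a free amalgamation theory, i.e. a complete theory admitting such a relation. 2. Every completion $T'$ of $T$ is non-modular: the relation $A\mathop{\perp\!\!\!\perp}^a_C B$ defined by $\mathrm{acl}(AC)\cap\mathrm{acl}(BC)=\mathrm{acl}(C)$ does not satisfy base monotonicity (if $A\mathop{\perp\!\!\!\perp}^a_B C$ and $B\subseteq D\subseteq C$, then $A\mathop{\perp\!\!\!\perp}^a_D C$),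 not even when the bases $B,D$ are required to be models (elementary submodels of the monster model). In particular, non-modular free amalgamation theories exist. -/

import Mathlib

namespace FreeAmalg

open scoped FirstOrder

section General

variable {L : FirstOrder.Language.{0, 0}}

/-- Algebraic closure: the elements of `M` lying in some finite `A`-definable subset of `M`. -/
def acl (L : FirstOrder.Language.{0, 0}) {M : Type} [L.Structure M] (A : Set M) : Set M :=
  {x | ∃ S : Set M, S.Finite ∧ A.Definable₁ L S ∧ x ∈ S}

/-- `A` is algebraically closed. -/
def AclClosed (L : FirstOrder.Language.{0, 0}) {M : Type} [L.Structure M] (A : Set M) : Prop :=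
  acl L A = A

/-- Two (possibly infinite) tuples, possibly in different structures, have the same complete type
over the empty set. -/
def EqType (L : FirstOrder.Language.{0, 0}) {M N : Type} [L.Structure M] [L.Structure N] {ι : Type}
    (v : ι → M) (w : ι → N) : Prop :=
  ∀ φ : L.Formula ι, φ.Realize v ↔ φ.Realize w

/-- `v ≡_C w`: the tuples `v` and `w` of elements of `M` have the same complete type over the
set `C` of parameters. -/
def EqTypeOver (L : FirstOrder.Language.{0, 0}) {M : Type} [L.Structure M] (C : Set M) {ι : Type}
    (v w : ι → M) : Prop :=
  EqType L (Sum.elim v (fun x : C => (x : M))) (Sum.elim w (fun x : C => (x : M)))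

/-- `Tstar` is a model completion of `T`: every model of `Tstar` is a model of `T`, every model
of `T` embeds in a model of `Tstar`, and for every model `A` of `T` any two models of `Tstar`
extending `A` satisfy the same formulas with parameters from `A` (that is, `Tstar` together with
the diagram of `A` is complete). -/
def IsModelCompletion (T Tstar : L.Theory) : Prop :=
  (∀ (M : Type) [L.Structure M] [Nonempty M], M ⊨ Tstar → M ⊨ T) ∧
  (∀ (M : Type) [L.Structure M] [Nonempty M], M ⊨ T →
    ∃ (N : Type) (_ : L.Structure N), N ⊨ Tstar ∧ Nonempty (M ↪[L] N)) ∧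
  (∀ (A N₁ N₂ : Type) [L.Structure A] [L.Structure N₁] [L.Structure N₂] [Nonempty A],
    A ⊨ T → N₁ ⊨ Tstar → N₂ ⊨ Tstar →
    ∀ (g₁ : A ↪[L] N₁) (g₂ : A ↪[L] N₂), EqType L (g₁ : A → N₁) (g₂ : A → N₂))

/-- A ternary relation between subsets of structures; `R M A B C` is read "`A` is independent
from `B` over `C` (in `M`)". -/
abbrev TernaryRel (L : FirstOrder.Language.{0, 0}) : Type 1 :=
  ∀ (M : Type) [L.Structure M], Set M → Set M → Set M → Prop

/-- Conant's axioms for a free amalgamation relation. Small subsets of a monster model of `T` are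
represented by arbitrary subsets of arbitrary models of `T`; accordingly the realization asked for
by full existence lives in an elementary extension, and invariance compares sets in possibly
different models. -/
structure IsFreeAmalgamationRelation (T : L.Theory) (R : TernaryRel L) : Prop where
  /-- Whether `A` is independent from `B` over `C` depends only on the type of `ABC`. -/
  invariance : ∀ (M N : Type) [L.Structure M] [L.Structure N] [Nonempty M] [Nonempty N],
    M ⊨ T → N ⊨ T → ∀ (ι : Type) (v : ι → M) (w : ι → N), EqType L v w →
    ∀ I J K : Set ι, R M (v '' I) (v '' J) (v '' K) ↔ R N (w '' I) (w '' J) (w '' K)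
  monotonicity : ∀ (M : Type) [L.Structure M] [Nonempty M], M ⊨ T →
    ∀ A B C A₀ B₀ : Set M, R M A B C → A₀ ⊆ A → B₀ ⊆ B → R M A₀ B₀ C
  fullTransitivity : ∀ (M : Type) [L.Structure M] [Nonempty M], M ⊨ T →
    ∀ A B C D : Set M, D ⊆ C → C ⊆ B → (R M A B D ↔ R M A C D ∧ R M A B C)
  fullExistence : ∀ (M : Type) [L.Structure M] [Nonempty M], M ⊨ T →
    ∀ (ι : Type) (a : ι → M) (B C : Set M), AclClosed L C →
    ∃ (N : Type) (_ : L.Structure N) (j : M ↪ₑ[L] N) (a' : ι → N),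
      EqTypeOver L (j '' C) a' (fun i => j (a i)) ∧ R N (Set.range a') (j '' B) (j '' C)
  stationarity : ∀ (M : Type) [L.Structure M] [Nonempty M], M ⊨ T →
    ∀ (ι : Type) (a a' : ι → M) (b C : Set M),
      AclClosed L (Set.range a) → AclClosed L b → AclClosed L C → C ⊆ Set.range a ∩ b →
      EqTypeOver L C a' a → R M (Set.range a) b C → R M (Set.range a') b C →
      EqTypeOver L b a' a
  freedom : ∀ (M : Type) [L.Structure M] [Nonempty M], M ⊨ T →
    ∀ A B C D : Set M, R M A B C → C ∩ (A ∪ B) ⊆ D → D ⊆ C → R M A B D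
  closure : ∀ (M : Type) [L.Structure M] [Nonempty M], M ⊨ T →
    ∀ a b C : Set M, AclClosed L a → AclClosed L b → AclClosed L C → C ⊆ a ∩ b →
      R M a b C → AclClosed L (a ∪ b)

/-- A free amalgamation theory: a complete theory with a free amalgamation relation. -/
def IsFreeAmalgamationTheory (T : L.Theory) : Prop :=
  T.IsComplete ∧ ∃ R : TernaryRel L, IsFreeAmalgamationRelation T R

/-- Algebraic independence: `acl(AC) ∩ acl(BC) = acl(C)`. -/
def AlgInd (L : FirstOrder.Language.{0, 0}) : TernaryRel L :=
  fun _ _ A B C => acl L (A ∪ C) ∩ acl L (B ∪ C) = acl L C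

/-- `T` is modular: algebraic independence has base monotonicity over arbitrary sets. -/
def IsModular (T : L.Theory) : Prop :=
  ∀ (M : Type) [L.Structure M] [Nonempty M], M ⊨ T →
    ∀ A B C D : Set M, AlgInd L M A C B → B ⊆ D → D ⊆ C → AlgInd L M A C D

/-- The version of modularity in which algebraic independence is only considered over models:
base monotonicity is asked for bases that are elementary substructures. -/
def IsModularOverModels (T : L.Theory) : Prop :=
  ∀ (M : Type) [L.Structure M] [Nonempty M], M ⊨ T →
    ∀ (A C : Set M) (B D : L.ElementarySubstructure M),
      AlgInd L M A C (B : Set M) → (B : Set M) ⊆ D → (D : Set M) ⊆ C →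
      AlgInd L M A C (D : Set M)

end General

/-- Function symbols: a constant `c` and a binary function symbol `f`. -/
inductive FunSym : ℕ → Type
  | c : FunSym 0
  | f : FunSym 2

/-- The language with one binary function symbol `f` and one constant symbol `c`. -/
def funLang : FirstOrder.Language.{0, 0} where
  Functions := FunSym
  Relations := fun _ => Empty

/-- The interpretation of the constant `c`. -/
def cst (M : Type) [funLang.Structure M] : M :=
  FirstOrder.Language.Structure.funMap (L := funLang) FunSym.c ![]

/-- The interpretation of the binary function `f`. -/
def fn {M : Type} [funLang.Structure M] (x y : M) : M :=
  FirstOrder.Language.Structure.funMap (L := funLang) FunSym.f ![x, y]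

/-- `A` is independent from `B` over `C`: `A ∩ B ⊆ C`, and `f(a,b) = f(b,a) = c` for all
`a ∈ A \ C` and `b ∈ B \ C`. -/
def FunInd : TernaryRel funLang :=
  fun M _ A B C => A ∩ B ⊆ C ∧
    ∀ a ∈ A \ C, ∀ b ∈ B \ C, fn a b = cst M ∧ fn b a = cst M

end FreeAmalg

/-!
The model completion of the empty theory is axiomatized by an extension property
(`HasExtensions`): over finitely many distinct elements, any table of values of `f` on pairs that
involve at least one of finitely many new elements is realized. A structure with this property is
existentially closed (`HasExtensions.exists_elementary`): finite parts of an extension `P` of `N`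
are copied into `N` over `N`, and these copies glue to an embedding of `P` into an ultrapower
of `N`. With the amalgamation of two extensions of a structure (`exists_free_amalgam`), an induction
on formulas shows that models of the axioms satisfy the same formulas over a common substructure
(`realize_iff_of_hasExtensions`). Every structure embeds in such a model, built as an inductive
type `Gen` whose constructor adds solutions of all tables over all tuples.

The rest concerns an arbitrary model completion `T`. By its definition, every structure extending a
model `M` of `T` embeds over `M` in a model of `T`, and embeddings between models of `T` are
elementary. Free amalgams can therefore be realized in elementary extensions. The free amalgam of
two copies of `M` over a substructure `X` shows that `X` is algebraically closed
(`IsModelCompletion.aclClosed`), since a finite `X`-definable set acquires no new elements in the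
amalgam, and it also gives full existence. Stationarity holds because independence determines `f` on
mixed pairs, so that the union of two independent substructures has a quantifier-free type
determined by those of its parts.

Modularity fails because algebraic closure is just generation by `f` and `c`: for models `B ⊆ D`,
`d ∈ D \ B` and new elements `a`, `e` with `f(a, d) = e`, the element `a` says nothing about `e`
over `B`, but over `D` it generates `e`.
-/

namespace FreeAmalg

open FirstOrder FirstOrder.Language

/-! ### Structures and embeddings for one binary function and one constant -/

/-- The structure on `M` in which `f` is interpreted by `op` and `c` by `k`. -/
@[reducible] def structureOf {M : Type} (op : M → M → M) (k : M) : funLang.Structure M where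
  funMap {n} g := match n, g with
    | 0, FunSym.c => fun _ => k
    | 2, FunSym.f => fun x => op (x 0) (x 1)
  RelMap r := r.elim

lemma map_cst {M N : Type} [funLang.Structure M] [funLang.Structure N] (g : M ↪[funLang] N) :
    g (cst M) = cst N :=
  (g.map_fun (FunSym.c : funLang.Functions 0) ![]).trans
    (congrArg (Structure.funMap (L := funLang) FunSym.c) (Subsingleton.elim _ _))

lemma map_fn {M N : Type} [funLang.Structure M] [funLang.Structure N] (g : M ↪[funLang] N)
    (x y : M) : g (fn x y) = fn (g x) (g y) :=
  (g.map_fun (FunSym.f : funLang.Functions 2) ![x, y]).trans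
    (congrArg (Structure.funMap (L := funLang) FunSym.f) (by funext i; fin_cases i <;> rfl))

/-- An injective map commuting with `f` and `c` is an embedding of structures. -/
def embeddingOf {M N : Type} [funLang.Structure M] [funLang.Structure N] (g : M → N)
    (hinj : Function.Injective g) (hc : g (cst M) = cst N)
    (hf : ∀ x y, g (fn x y) = fn (g x) (g y)) : M ↪[funLang] N where
  toFun := g
  inj' := hinj
  map_fun' {n} s x := match n, s with
    | 0, FunSym.c => by
      have h1 : x = ![] := Subsingleton.elim _ _
      have h2 : g ∘ x = ![] := Subsingleton.elim _ _
      rw [h2, h1]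
      exact hc
    | 2, FunSym.f => by
      have h1 : x = ![x 0, x 1] := by funext i; fin_cases i <;> rfl
      have h2 : g ∘ x = ![g (x 0), g (x 1)] := by funext i; fin_cases i <;> rfl
      rw [h2, h1]
      exact hf _ _
  map_rel' r := r.elim

@[simp] lemma embeddingOf_apply {M N : Type} [funLang.Structure M] [funLang.Structure N]
    (g : M → N) (hinj : Function.Injective g) (hc : g (cst M) = cst N)
    (hf : ∀ x y, g (fn x y) = fn (g x) (g y)) (x : M) : embeddingOf g hinj hc hf x = g x := rfl

/-- The term `f(s, t)`. -/
def fnTerm {α : Type} (s t : funLang.Term α) : funLang.Term α :=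
  Term.func (L := funLang) (FunSym.f : FunSym 2) ![s, t]

/-- The term `c`. -/
def cstTerm {α : Type} : funLang.Term α :=
  Term.func (L := funLang) (FunSym.c : FunSym 0) ![]

@[simp] lemma realize_fnTerm {α M : Type} [funLang.Structure M] (s t : funLang.Term α)
    (v : α → M) : (fnTerm s t).realize v = fn (s.realize v) (t.realize v) :=
  congrArg (Structure.funMap (L := funLang) FunSym.f) (by funext i; fin_cases i <;> rfl)

@[simp] lemma realize_cstTerm {α M : Type} [funLang.Structure M] (v : α → M) :
    (cstTerm : funLang.Term α).realize v = cst M :=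
  congrArg (Structure.funMap (L := funLang) FunSym.c) (Subsingleton.elim _ _)

/-- `X` is (the universe of) a substructure. -/
def ClosedUnder {M : Type} [funLang.Structure M] (X : Set M) : Prop :=
  cst M ∈ X ∧ ∀ x ∈ X, ∀ y ∈ X, fn x y ∈ X

/-- The structure induced on a subset closed under `f` and `c`. -/
@[reducible] def ClosedUnder.structure {M : Type} [funLang.Structure M] {X : Set M}
    (hX : ClosedUnder X) : funLang.Structure X :=
  structureOf (fun x y => ⟨fn x.1 y.1, hX.2 x x.2 y y.2⟩) ⟨cst M, hX.1⟩

lemma closedUnder_range {M N : Type} [funLang.Structure M] [funLang.Structure N]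
    (g : M ↪[funLang] N) : ClosedUnder (Set.range g) := by
  refine ⟨⟨cst M, map_cst g⟩, ?_⟩
  rintro _ ⟨x, rfl⟩ _ ⟨y, rfl⟩
  exact ⟨fn x y, map_fn g x y⟩

/-! ### Free amalgams -/

/-- Two extensions `N` and `B` of a structure `A` can be amalgamated disjointly over `A` so that
`f` takes the value `c` on all pairs with one entry in `N \ A` and the other in `B \ A`. -/
lemma exists_free_amalgam {A N B : Type} [funLang.Structure A] [funLang.Structure N]
    [funLang.Structure B] (g : A ↪[funLang] N) (h : A ↪[funLang] B) :
    ∃ (P : Type) (_ : funLang.Structure P) (j : N ↪[funLang] P) (k : B ↪[funLang] P),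
      (∀ a, j (g a) = k (h a)) ∧ (∀ x b, j x = k b → ∃ a, x = g a ∧ b = h a) ∧
      ∀ x ∉ Set.range g, ∀ b ∉ Set.range h,
        fn (j x) (k b) = cst P ∧ fn (k b) (j x) = cst P := by
  classical
  let P := N ⊕ {b : B // b ∉ Set.range h}
  let k : B → P := fun b => if hb : b ∈ Set.range h then Sum.inl (g hb.choose) else Sum.inr ⟨b, hb⟩
  have kh : ∀ a, k (h a) = Sum.inl (g a) := by
    intro a
    have ha : h a ∈ Set.range h := ⟨a, rfl⟩
    simp only [k, dif_pos ha]
    rw [h.injective ha.choose_spec]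
  have kn : ∀ b (hb : b ∉ Set.range h), k b = Sum.inr ⟨b, hb⟩ := fun b hb => dif_neg hb
  have kinl : ∀ x b, Sum.inl x = k b → ∃ a, x = g a ∧ b = h a := by
    intro x b hx
    by_cases hb : b ∈ Set.range h
    · obtain ⟨a, rfl⟩ := hb
      rw [kh] at hx
      exact ⟨a, Sum.inl.inj hx, rfl⟩
    · rw [kn b hb] at hx
      cases hx
  have kinj : Function.Injective k := by
    intro b b' hbb
    by_cases hb : b ∈ Set.range h
    · obtain ⟨a, rfl⟩ := hb
      rw [kh] at hbb
      obtain ⟨a', ha, rfl⟩ := kinl _ _ hbb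
      rw [g.injective ha]
    · by_cases hb' : b' ∈ Set.range h
      · obtain ⟨a, rfl⟩ := hb'
        rw [kh, kn b hb] at hbb
        cases hbb
      · rw [kn b hb, kn b' hb'] at hbb
        exact congrArg Subtype.val (Sum.inr.inj hbb)
  let op : P → P → P := fun p q =>
    if hN : ∃ x y, p = Sum.inl x ∧ q = Sum.inl y then Sum.inl (fn hN.choose hN.choose_spec.choose)
    else if hB : ∃ b b', p = k b ∧ q = k b' then k (fn hB.choose hB.choose_spec.choose)
    else Sum.inl (cst N)
  have opN : ∀ x y, op (Sum.inl x) (Sum.inl y) = Sum.inl (fn x y) := by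
    intro x y
    have hN : ∃ x' y', (Sum.inl x : P) = Sum.inl x' ∧ (Sum.inl y : P) = Sum.inl y' :=
      ⟨x, y, rfl, rfl⟩
    have e := hN.choose_spec.choose_spec
    exact (dif_pos hN).trans
      (congrArg Sum.inl (congrArg₂ fn (Sum.inl.inj e.1).symm (Sum.inl.inj e.2).symm))
  have opB : ∀ b b', op (k b) (k b') = k (fn b b') := by
    intro b b'
    by_cases hN : ∃ x y, k b = Sum.inl x ∧ k b' = Sum.inl y
    · obtain ⟨x, y, hx, hy⟩ := hN
      obtain ⟨a, rfl, rfl⟩ := kinl _ _ hx.symm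
      obtain ⟨a', rfl, rfl⟩ := kinl _ _ hy.symm
      rw [hx, hy, opN, ← map_fn, ← map_fn, kh]
    · have hB : ∃ b₁ b₂, k b = k b₁ ∧ k b' = k b₂ := ⟨b, b', rfl, rfl⟩
      have e := hB.choose_spec.choose_spec
      exact (dif_neg hN).trans <| (dif_pos hB).trans
        (congrArg k (congrArg₂ fn (kinj e.1).symm (kinj e.2).symm))
  let _ : funLang.Structure P := structureOf op (Sum.inl (cst N))
  have cP : cst P = Sum.inl (cst N) := rfl
  have fP : ∀ p q : P, fn p q = op p q := fun _ _ => rfl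
  refine ⟨P, inferInstance, embeddingOf Sum.inl Sum.inl_injective rfl
    (fun x y => ((fP _ _).trans (opN x y)).symm),
    embeddingOf k kinj (by rw [← map_cst h, kh, map_cst, cP])
      (fun x y => ((fP _ _).trans (opB x y)).symm), ?_, ?_, ?_⟩
  · intro a
    simp only [embeddingOf_apply]
    exact (kh a).symm
  · intro x b hx
    exact kinl x b hx
  · intro x hx b hb
    simp only [embeddingOf_apply, fP, cP]
    constructor
    · have h1 : ¬ ∃ x' y', (Sum.inl x : P) = Sum.inl x' ∧ k b = Sum.inl y' := by
        rintro ⟨x', y', -, hy⟩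
        obtain ⟨a, -, rfl⟩ := kinl _ _ hy.symm
        exact hb ⟨a, rfl⟩
      have h2 : ¬ ∃ b₁ b₂, (Sum.inl x : P) = k b₁ ∧ k b = k b₂ := by
        rintro ⟨b₁, b₂, hy, -⟩
        obtain ⟨a, rfl, -⟩ := kinl _ _ hy
        exact hx ⟨a, rfl⟩
      exact (dif_neg h1).trans (dif_neg h2)
    · have h1 : ¬ ∃ x' y', k b = Sum.inl x' ∧ (Sum.inl x : P) = Sum.inl y' := by
        rintro ⟨x', y', hy, -⟩
        obtain ⟨a, -, rfl⟩ := kinl _ _ hy.symm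
        exact hb ⟨a, rfl⟩
      have h2 : ¬ ∃ b₁ b₂, k b = k b₁ ∧ (Sum.inl x : P) = k b₂ := by
        rintro ⟨b₁, b₂, -, hy⟩
        obtain ⟨a, rfl, -⟩ := kinl _ _ hy
        exact hx ⟨a, rfl⟩
      exact (dif_neg h1).trans (dif_neg h2)

/-! ### Extension axioms -/

/-- The extension property: every table prescribing the values of `f` on the pairs of elements of
`{x₁, …, xₙ, y₁, …, yₘ}` that involve some `yᵢ` is realized, over all distinct `x₁, …, xₙ`, by
elements `y₁, …, yₘ` distinct from each other and from the `xᵢ`. The entries of the table `t` at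
pairs of old elements are ignored. -/
def HasExtensions (M : Type) [funLang.Structure M] : Prop :=
  ∀ (n m : ℕ) (t : Fin n ⊕ Fin m → Fin n ⊕ Fin m → Fin n ⊕ Fin m) (x : Fin n → M),
    Function.Injective x → ∃ y : Fin m → M, Function.Injective (Sum.elim x y) ∧
      ∀ u v, (u.isRight ∨ v.isRight) →
        fn (Sum.elim x y u) (Sum.elim x y v) = Sum.elim x y (t u v)

/-- The formula saying that the variables `z i` take pairwise distinct values. -/
noncomputable def distinctFormula {α ι : Type} [Finite ι] (z : ι → α) : funLang.Formula α :=
  Formula.iInf fun p : {p : ι × ι // p.1 ≠ p.2} =>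
    (Term.equal (Term.var (z p.1.1)) (Term.var (z p.1.2))).not

lemma realize_distinctFormula {α ι M : Type} [Finite ι] [funLang.Structure M] (z : ι → α)
    (v : α → M) : (distinctFormula z).Realize v ↔ Function.Injective (v ∘ z) := by
  simp only [distinctFormula, Formula.realize_iInf, Formula.realize_not, Formula.realize_equal,
    Term.realize_var]
  constructor
  · intro h i j hij
    by_contra hne
    exact h ⟨(i, j), hne⟩ hij
  · rintro h ⟨⟨i, j⟩, hne⟩ hij
    exact hne (h hij)

/-- The sentence saying that the table `t` is realized over any `n` distinct elements. -/
noncomputable def extAxiom (n m : ℕ) (t : Fin n ⊕ Fin m → Fin n ⊕ Fin m → Fin n ⊕ Fin m) :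
    funLang.Sentence :=
  Formula.iAlls (Fin n) (α := Empty) <|
    (distinctFormula (Sum.inr : Fin n → Empty ⊕ Fin n)).imp <|
      Formula.iExs (Fin m) <|
        distinctFormula (Sum.map Sum.inr id : Fin n ⊕ Fin m → (Empty ⊕ Fin n) ⊕ Fin m) ⊓
        Formula.iInf fun p : {p : (Fin n ⊕ Fin m) × (Fin n ⊕ Fin m) // p.1.isRight ∨ p.2.isRight} =>
          Term.equal
            (fnTerm (Term.var (Sum.map Sum.inr id p.1.1)) (Term.var (Sum.map Sum.inr id p.1.2)))
            (Term.var (Sum.map Sum.inr id (t p.1.1 p.1.2)))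

/-- The theory axiomatizing the extension property. -/
def extTheory : funLang.Theory := {φ | ∃ n m t, φ = extAxiom n m t}

lemma realize_extAxiom {M : Type} [funLang.Structure M] (n m : ℕ)
    (t : Fin n ⊕ Fin m → Fin n ⊕ Fin m → Fin n ⊕ Fin m) :
    M ⊨ extAxiom n m t ↔ ∀ x : Fin n → M, Function.Injective x →
      ∃ y : Fin m → M, Function.Injective (Sum.elim x y) ∧
        ∀ u v, (u.isRight ∨ v.isRight) →
          fn (Sum.elim x y u) (Sum.elim x y v) = Sum.elim x y (t u v) := by
  have key : ∀ (x : Fin n → M) (y : Fin m → M) (w : Empty → M),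
      Sum.elim (Sum.elim w x) y ∘ Sum.map Sum.inr id = Sum.elim x y := by
    intro x y w
    funext u
    rcases u with u | u <;> rfl
  have key' : ∀ (x : Fin n → M) (y : Fin m → M) (w : Empty → M) u,
      Sum.elim (Sum.elim w x) y (Sum.map Sum.inr id u) = Sum.elim x y u :=
    fun x y w u => congrFun (key x y w) u
  simp only [extAxiom, Sentence.Realize, Formula.realize_iAlls, Formula.realize_imp,
    Formula.realize_iExs, Formula.realize_inf, realize_distinctFormula, Formula.realize_iInf,
    Formula.realize_equal, realize_fnTerm, Term.realize_var, key, key', Sum.elim_comp_inr,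
    Subtype.forall, Prod.forall]

lemma models_extTheory_iff {M : Type} [funLang.Structure M] :
    M ⊨ extTheory ↔ HasExtensions M := by
  rw [Theory.model_iff]
  constructor
  · intro h n m t
    exact (realize_extAxiom n m t).1 (h _ ⟨n, m, t, rfl⟩)
  · rintro h _ ⟨n, m, t, rfl⟩
    exact (realize_extAxiom n m t).2 (h n m t)

/-! ### Every structure embeds in one with the extension property -/

/-- The universe of the structure obtained from `A` by freely adding solutions `y₁, …, yₘ` of every
table `t` over every tuple `x`, including tuples of elements added before. -/
inductive Gen (A : Type) : Type
  | base : A → Gen A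
  | new (n m : ℕ) (t : Fin n ⊕ Fin m → Fin n ⊕ Fin m → Fin n ⊕ Fin m) (x : Fin n → Gen A)
      (i : Fin m) : Gen A

namespace Gen

variable {A : Type}

/-- The stage at which an element is added. -/
def depth : Gen A → ℕ
  | base _ => 0
  | new _ _ _ x _ => (Finset.univ.sup fun j => depth (x j)) + 1

/-- The elements of the block of a table `t` over a tuple `x`: those of `x` and the new ones. -/
def block (n m : ℕ) (t : Fin n ⊕ Fin m → Fin n ⊕ Fin m → Fin n ⊕ Fin m) (x : Fin n → Gen A) :
    Fin n ⊕ Fin m → Gen A :=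
  Sum.elim x (new n m t x)

lemma depth_lt (n m : ℕ) (t : Fin n ⊕ Fin m → Fin n ⊕ Fin m → Fin n ⊕ Fin m) (x : Fin n → Gen A)
    (i : Fin m) (j : Fin n) : (x j).depth < (new n m t x i).depth := by
  rw [depth, Nat.lt_succ_iff]
  exact Finset.le_sup (f := fun j => depth (x j)) (Finset.mem_univ j)

lemma depth_new (n m : ℕ) (t : Fin n ⊕ Fin m → Fin n ⊕ Fin m → Fin n ⊕ Fin m)
    (x : Fin n → Gen A) (i j : Fin m) : (new n m t x i).depth = (new n m t x j).depth := by
  rw [depth, depth]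

lemma block_injective (n m : ℕ) (t : Fin n ⊕ Fin m → Fin n ⊕ Fin m → Fin n ⊕ Fin m)
    {x : Fin n → Gen A} (hx : Function.Injective x) : Function.Injective (block n m t x) := by
  rintro (a | a) (b | b) hab
  · exact congrArg _ (hx hab)
  · exact absurd (congrArg depth hab) (depth_lt n m t x b a).ne
  · exact absurd (congrArg depth hab) (depth_lt n m t x a b).ne'
  · simp only [block, Sum.elim_inr, new.injEq, heq_eq_eq, true_and] at hab
    rw [hab]

/-- Some table prescribes the value `w` for `f(u, v)`. -/
def Prescribed (u v w : Gen A) : Prop :=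
  ∃ n m t, ∃ x : Fin n → Gen A, Function.Injective x ∧ ∃ a b : Fin n ⊕ Fin m,
    (a.isRight ∨ b.isRight) ∧ u = block n m t x a ∧ v = block n m t x b ∧ w = block n m t x (t a b)

/-- A pair of elements determines the table prescribing its value: the deeper of the two elements
is a new element of that table. -/
lemma Prescribed.unique {u v w w' : Gen A} (h : Prescribed u v w) (h' : Prescribed u v w') :
    w = w' := by
  obtain ⟨n, m, t, x, hx, a, b, hab, hu, hv, rfl⟩ := h
  obtain ⟨n', m', t', x', hx', a', b', hab', hu', hv', rfl⟩ := h'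
  suffices H : ∀ i i', new n m t x i = new n' m' t' x' i' →
      block n m t x (t a b) = block n' m' t' x' (t' a' b') by
    rcases a with a | a <;> rcases a' with a' | a'
    · rcases b with b | b
      · simp at hab
      rcases b' with b' | b'
      · simp at hab'
      exact H b b' (hv.symm.trans hv')
    · rcases b with b | b
      · simp at hab
      exfalso
      have h1 := depth_lt n m t x b a
      have e1 : x a = new n' m' t' x' a' := hu.symm.trans hu'
      have e2 : new n m t x b = block n' m' t' x' b' := hv.symm.trans hv'
      rw [e1, e2] at h1
      rcases b' with b' | b'
      · exact (h1.trans (depth_lt n' m' t' x' a' b')).false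
      · exact h1.ne (depth_new n' m' t' x' a' b')
    · rcases b' with b' | b'
      · simp at hab'
      exfalso
      have h1 := depth_lt n' m' t' x' b' a'
      have e1 : x' a' = new n m t x a := hu'.symm.trans hu
      have e2 : new n' m' t' x' b' = block n m t x b := hv'.symm.trans hv
      rw [e1, e2] at h1
      rcases b with b | b
      · exact (h1.trans (depth_lt n m t x a b)).false
      · exact h1.ne (depth_new n m t x a b)
    · exact H a a' (hu.symm.trans hu')
  intro i i' hi
  rw [new.injEq] at hi
  obtain ⟨rfl, rfl, ht, hxx, -⟩ := hi
  obtain rfl := eq_of_heq ht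
  obtain rfl := eq_of_heq hxx
  rw [block_injective n m t hx (hu.symm.trans hu'), block_injective n m t hx (hv.symm.trans hv')]

open Classical in
/-- The operation on `Gen A`: that of `A` on old elements, the prescribed value where there is one,
and `c` otherwise. -/
noncomputable def op [funLang.Structure A] : Gen A → Gen A → Gen A
  | base a, base b => base (fn a b)
  | u, v =>
    if h : ∃ w, Prescribed u v w then h.choose else base (cst A)

noncomputable instance [funLang.Structure A] : funLang.Structure (Gen A) :=
  structureOf op (base (cst A))

open Classical in
lemma fn_eq_of_prescribed [funLang.Structure A] {u v w : Gen A} (h : Prescribed u v w) :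
    fn u v = w := by
  have hfn : fn u v = op u v := rfl
  have hex : ∃ w, Prescribed u v w := ⟨w, h⟩
  have hval : (if h : ∃ w, Prescribed u v w then h.choose else base (cst A)) = w := by
    rw [dif_pos hex]
    exact hex.choose_spec.unique h
  rw [hfn]
  rcases u with a | ⟨n, m, t, x, i⟩
  · rcases v with b | ⟨n, m, t, x, i⟩
    · exfalso
      obtain ⟨n, m, t, x, -, a' | a', b' | b', hab, hu, hv, -⟩ := h
      · simp at hab
      all_goals first | cases hu | cases hv
    · exact hval
  · exact hval

lemma hasExtensions [funLang.Structure A] : HasExtensions (Gen A) := by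
  intro n m t x hx
  refine ⟨new n m t x, block_injective n m t hx, ?_⟩
  intro u v huv
  exact fn_eq_of_prescribed ⟨n, m, t, x, hx, u, v, huv, rfl, rfl, rfl⟩

/-- The inclusion of `A` in `Gen A`. -/
noncomputable def baseEmbedding [funLang.Structure A] : A ↪[funLang] Gen A :=
  embeddingOf base (fun _ _ h => base.inj h) rfl (fun _ _ => rfl)

end Gen

/-! ### Structures with the extension property are existentially closed -/

/-- If `N` has the extension property, then every finite part of an extension `P` of `N` can be
copied into `N` over `N`. -/
lemma HasExtensions.exists_local_retraction {N P : Type} [funLang.Structure N]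
    [funLang.Structure P] (hN : HasExtensions N) (i : N ↪[funLang] P) (S : Finset P) :
    ∃ e : P → N, (∀ x, e (i x) = x) ∧ Set.InjOn e S ∧
      ∀ p ∈ S, ∀ q ∈ S, fn p q ∈ S → e (fn p q) = fn (e p) (e q) := by
  classical
  let old : Finset N := S.preimage i i.injective.injOn
  let new : Finset P := S.filter (· ∉ Set.range i)
  let x : Fin old.card → N := fun k => old.equivFin.symm k
  let z : Fin new.card → P := fun k => new.equivFin.symm k
  have hx : Function.Injective x := Subtype.val_injective.comp old.equivFin.symm.injective
  have hz : Function.Injective z := Subtype.val_injective.comp new.equivFin.symm.injective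
  have hzi : ∀ k a, i a ≠ z k := fun k a h =>
    (Finset.mem_filter.1 (new.equivFin.symm k).2).2 ⟨a, h⟩
  let val : Fin old.card ⊕ Fin new.card → P := Sum.elim (i ∘ x) z
  have hval : Function.Injective val :=
    Function.Injective.sumElim (i.injective.comp hx) hz fun a k => hzi k _
  have hS : ∀ p ∈ S, ∃ w, val w = p := by
    intro p hp
    by_cases h : p ∈ Set.range i
    · obtain ⟨a, rfl⟩ := h
      have ha : a ∈ old := Finset.mem_preimage.2 hp
      exact ⟨Sum.inl (old.equivFin ⟨a, ha⟩), by simp [val, x]⟩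
    · have ha : p ∈ new := Finset.mem_filter.2 ⟨hp, h⟩
      exact ⟨Sum.inr (new.equivFin ⟨p, ha⟩), by simp [val, z]⟩
  -- The table of `f` on `S`; products leaving `S` get an arbitrary value.
  let t : Fin old.card ⊕ Fin new.card → Fin old.card ⊕ Fin new.card →
      Fin old.card ⊕ Fin new.card := fun u v =>
    if h : ∃ w, val w = fn (val u) (val v) then h.choose else u
  have ht : ∀ u v w, val w = fn (val u) (val v) → t u v = w := by
    intro u v w hw
    have h : ∃ w, val w = fn (val u) (val v) := ⟨w, hw⟩
    simp only [t, dif_pos h]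
    exact hval (h.choose_spec.trans hw.symm)
  obtain ⟨y, hxy, hy⟩ := hN _ _ t x hx
  let e : P → N := fun p =>
    if h : ∃ a, i a = p then h.choose else if h : ∃ k, z k = p then y h.choose else cst N
  have ei : ∀ a, e (i a) = a := by
    intro a
    have h : ∃ b, i b = i a := ⟨a, rfl⟩
    simp only [e, dif_pos h]
    exact i.injective h.choose_spec
  have ez : ∀ k, e (z k) = y k := by
    intro k
    have h1 : ¬ ∃ b, i b = z k := fun ⟨b, hb⟩ => hzi k b hb
    have h : ∃ l, z l = z k := ⟨k, rfl⟩
    simp only [e, dif_neg h1, dif_pos h]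
    rw [hz h.choose_spec]
  have eval : ∀ w, e (val w) = Sum.elim x y w := by
    rintro (a | k)
    · exact ei _
    · exact ez k
  refine ⟨e, ei, ?_, ?_⟩
  · intro p hp q hq hpq
    obtain ⟨u, rfl⟩ := hS p hp
    obtain ⟨v, rfl⟩ := hS q hq
    rw [eval, eval] at hpq
    rw [hxy hpq]
  · intro p hp q hq hpq
    obtain ⟨u, rfl⟩ := hS p hp
    obtain ⟨v, rfl⟩ := hS q hq
    by_cases huv : u.isRight ∨ v.isRight
    · obtain ⟨w, hw⟩ := hS _ hpq
      rw [eval, eval, hy u v huv, ht u v w hw, ← hw, eval]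
    · rcases u with a | a
      · rcases v with b | b
        · change e (fn (i (x a)) (i (x b))) = fn (e (i (x a))) (e (i (x b)))
          rw [← map_fn, ei, ei, ei]
        · simp at huv
      · simp at huv

lemma fn_product {α N : Type} [funLang.Structure N] (u : Ultrafilter α) (a b : α → N) :
    fn (a : (u : Filter α).Product fun _ => N) (b : (u : Filter α).Product fun _ => N) =
      ((fun s => fn (a s) (b s) : α → N) : (u : Filter α).Product fun _ => N) := by
  unfold fn
  have h := Ultraproduct.funMap_cast (L := funLang) (M := fun _ : α => N) (u := u)
    (FunSym.f : FunSym 2) ![a, b]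
  have e1 : (fun i => ((![a, b] i : α → N) : (u : Filter α).Product fun _ => N)) =
      ![(a : (u : Filter α).Product fun _ => N), (b : (u : Filter α).Product fun _ => N)] := by
    funext i
    fin_cases i <;> rfl
  have e2 : ∀ s, (fun i => ![a, b] i s) = ![a s, b s] := by
    intro s
    funext i
    fin_cases i <;> rfl
  simp only [e2] at h
  rw [← h, ← e1]

/-- A structure with the extension property is existentially closed: each of its extensions embeds
over it in an elementary extension. The latter is an ultrapower over the finite subsets of the
extension, into which the local retractions glue to an embedding. -/
lemma HasExtensions.exists_elementary {N P : Type} [funLang.Structure N] [funLang.Structure P]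
    (hN : HasExtensions N) (i : N ↪[funLang] P) :
    ∃ (N' : Type) (_ : funLang.Structure N') (j : N ↪ₑ[funLang] N') (k : P ↪[funLang] N'),
      ∀ x, k (i x) = j x := by
  classical
  have : Nonempty N := ⟨cst N⟩
  choose e he using fun S : Finset P => hN.exists_local_retraction i S
  let u : Ultrafilter (Finset P) := Ultrafilter.of Filter.atTop
  have hu : ∀ S₀ : Finset P, ∀ᶠ S in (u : Filter (Finset P)), S₀ ⊆ S := fun S₀ =>
    Ultrafilter.of_le _ (Filter.eventually_ge_atTop S₀)
  let N' := (u : Filter (Finset P)).Product fun _ => N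
  let k : P → N' := fun p => ((fun S => e S p : Finset P → N) : N')
  let j : N ↪ₑ[funLang] N' :=
    { toFun := fun x => ((fun _ => x : Finset P → N) : N')
      map_formula' := by
        intro n φ x
        have := Ultraproduct.realize_formula_cast (L := funLang) (M := fun _ : Finset P => N)
          (u := u) φ (fun i _ => x i)
        refine this.trans ?_
        simp }
  have hk : ∀ x, k (i x) = j x := by
    intro x
    have : (fun S => e S (i x)) = fun _ => x := funext fun S => (he S).1 x
    simp only [k, this]
    rfl
  refine ⟨N', inferInstance, j, embeddingOf k ?_ ?_ ?_, hk⟩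
  · intro p q hpq
    have h1 : ∀ᶠ S in (u : Filter (Finset P)), e S p = e S q := Quotient.eq''.1 hpq
    obtain ⟨S, hS, hS'⟩ := (h1.and (hu {p, q})).exists
    exact (he S).2.1 (hS' (by simp)) (hS' (by simp)) hS
  · rw [← map_cst i, hk]
    exact map_cst j.toEmbedding
  · intro p q
    refine Eq.trans (Quotient.eq''.2 ?_) (fn_product u _ _).symm
    refine (hu {p, q, fn p q}).mono fun S hS => ?_
    exact (he S).2.2 p (hS (by simp)) q (hS (by simp)) (hS (by simp))

/-! ### The model completion of the empty theory -/

/-- Two structures with the extension property satisfy the same formulas with parameters from a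
common substructure. -/
lemma realize_iff_of_hasExtensions {α : Type} {n : ℕ} (φ : funLang.BoundedFormula α n) :
    ∀ {A N₁ N₂ : Type} [funLang.Structure A] [funLang.Structure N₁] [funLang.Structure N₂],
      N₁ ⊨ extTheory → N₂ ⊨ extTheory → ∀ (g₁ : A ↪[funLang] N₁) (g₂ : A ↪[funLang] N₂)
      (v : α → A) (xs : Fin n → A), φ.Realize (g₁ ∘ v) (g₁ ∘ xs) ↔ φ.Realize (g₂ ∘ v) (g₂ ∘ xs) := by
  induction φ with
  | falsum => intros; rfl
  | equal s t =>
    intro A N₁ N₂ _ _ _ _ _ g₁ g₂ v xs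
    simp only [BoundedFormula.Realize, ← Sum.comp_elim, HomClass.realize_term,
      g₁.injective.eq_iff, g₂.injective.eq_iff]
  | rel r => exact r.elim
  | imp φ ψ ih₁ ih₂ =>
    intro A N₁ N₂ _ _ _ h₁ h₂ g₁ g₂ v xs
    simp only [BoundedFormula.realize_imp, ih₁ h₁ h₂ g₁ g₂, ih₂ h₁ h₂ g₁ g₂]
  | @all n φ ih =>
    suffices H : ∀ {A N₁ N₂ : Type} [funLang.Structure A] [funLang.Structure N₁]
        [funLang.Structure N₂], N₁ ⊨ extTheory → N₂ ⊨ extTheory →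
        ∀ (g₁ : A ↪[funLang] N₁) (g₂ : A ↪[funLang] N₂) (v : α → A) (xs : Fin n → A),
        φ.all.Realize (g₁ ∘ v) (g₁ ∘ xs) → φ.all.Realize (g₂ ∘ v) (g₂ ∘ xs) by
      intro A N₁ N₂ _ _ _ h₁ h₂ g₁ g₂ v xs
      exact ⟨H h₁ h₂ g₁ g₂ v xs, H h₂ h₁ g₂ g₁ v xs⟩
    intro A N₁ N₂ _ _ _ h₁ h₂ g₁ g₂ v xs hall d
    -- Move `N₂` over `A` into an elementary extension `N'` of `N₁`, and compare `N'` with `N₂`.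
    obtain ⟨P, _, j, k, hjk, -⟩ := exists_free_amalgam g₁ g₂
    obtain ⟨N', _, j', k', hjk'⟩ := (models_extTheory_iff.1 h₁).exists_elementary j
    have h' : N' ⊨ extTheory := (j'.theory_model_iff _).1 h₁
    have hg : ∀ {β : Type} (w : β → A), j' ∘ g₁ ∘ w = k'.comp k ∘ g₂ ∘ w := by
      intro β w
      funext b
      simp only [Function.comp_apply, Embedding.comp_apply, ← hjk', hjk]
    rw [← j'.map_boundedFormula, hg, hg] at hall
    have h1 := hall (k'.comp k d)
    rw [← Fin.comp_snoc] at h1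
    exact (ih h' h₂ (k'.comp k) (Embedding.refl funLang N₂) (g₂ ∘ v) (Fin.snoc (g₂ ∘ xs) d)).1 h1

lemma isModelCompletion_extTheory : IsModelCompletion ∅ extTheory := by
  refine ⟨?_, ?_, ?_⟩
  · intro M _ _ _
    infer_instance
  · intro M _ _ _
    exact ⟨Gen M, inferInstance, models_extTheory_iff.2 Gen.hasExtensions, ⟨Gen.baseEmbedding⟩⟩
  · intro A N₁ N₂ _ _ _ _ _ h₁ h₂ g₁ g₂ φ
    have h := realize_iff_of_hasExtensions φ h₁ h₂ g₁ g₂ id Fin.elim0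
    rw [Function.comp_id, Function.comp_id] at h
    unfold Formula.Realize
    convert h

/-! ### Embeddings between models of a model completion -/

section ModelCompletion

variable {T : funLang.Theory}

/-- Every extension of a structure embeds in a model of a model completion. -/
lemma IsModelCompletion.exists_model (hT : IsModelCompletion ∅ T) (P : Type)
    [funLang.Structure P] :
    ∃ (N : Type) (_ : funLang.Structure N), N ⊨ T ∧ Nonempty (P ↪[funLang] N) := by
  have : Nonempty P := ⟨cst P⟩
  exact hT.2.1 P inferInstance

/-- Embeddings of a structure in two models of a model completion preserve the same formulas. -/
lemma IsModelCompletion.realize_iff (hT : IsModelCompletion ∅ T) {A N₁ N₂ : Type}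
    [funLang.Structure A] [funLang.Structure N₁] [funLang.Structure N₂] (h₁ : N₁ ⊨ T)
    (h₂ : N₂ ⊨ T) (g₁ : A ↪[funLang] N₁) (g₂ : A ↪[funLang] N₂) {ι : Type} (v : ι → A)
    (φ : funLang.Formula ι) : φ.Realize (g₁ ∘ v) ↔ φ.Realize (g₂ ∘ v) := by
  have : Nonempty A := ⟨cst A⟩
  have h := hT.2.2 A N₁ N₂ inferInstance h₁ h₂ g₁ g₂ (φ.relabel v)
  rwa [Formula.realize_relabel, Formula.realize_relabel] at h

/-- A model completion is model complete: embeddings between its models are elementary. -/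
def IsModelCompletion.toElementary (hT : IsModelCompletion ∅ T) {M N : Type}
    [funLang.Structure M] [funLang.Structure N] (hM : M ⊨ T) (hN : N ⊨ T) (g : M ↪[funLang] N) :
    M ↪ₑ[funLang] N where
  toFun := g
  map_formula' _ φ x := hT.realize_iff hN hM g (Embedding.refl funLang M) x φ

/-- Quantifier elimination for tuples: if the values of `v` form a substructure and `v i ↦ w i` is
a well-defined injection respecting `f` and `c`, then `v` and `w` have the same type. -/
lemma IsModelCompletion.eqType (hT : IsModelCompletion ∅ T) {M N ι : Type}
    [funLang.Structure M] [funLang.Structure N] (hM : M ⊨ T) (hN : N ⊨ T) (v : ι → M) (w : ι → N)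
    (heq : ∀ i j, v i = v j ↔ w i = w j) (hc : ∃ k, v k = cst M ∧ w k = cst N)
    (hf : ∀ i j, ∃ k, fn (v i) (v j) = v k ∧ fn (w i) (w j) = w k) : EqType funLang v w := by
  have hcl : ClosedUnder (Set.range v) := by
    obtain ⟨k, hk, -⟩ := hc
    refine ⟨⟨k, hk⟩, ?_⟩
    rintro _ ⟨i, rfl⟩ _ ⟨j, rfl⟩
    obtain ⟨k, hk, -⟩ := hf i j
    exact ⟨k, hk.symm⟩
  let _ := hcl.structure
  choose s hs using fun x : Set.range v => x.2
  have hs' : ∀ (x : Set.range v) k, x.1 = v k → w (s x) = w k := fun x k hk =>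
    (heq _ _).1 ((hs x).trans hk)
  let g₁ : Set.range v ↪[funLang] M :=
    embeddingOf Subtype.val Subtype.val_injective rfl (fun _ _ => rfl)
  let g₂ : Set.range v ↪[funLang] N := embeddingOf (fun x => w (s x))
    (fun x y hxy => Subtype.ext <| by rw [← hs x, ← hs y]; exact (heq _ _).2 hxy)
    (by
      obtain ⟨k, hk, hk'⟩ := hc
      exact (hs' (cst (Set.range v)) k hk.symm).trans hk')
    (by
      intro x y
      obtain ⟨k, hk, hk'⟩ := hf (s x) (s y)
      rw [hs x, hs y] at hk
      exact (hs' (fn x y) k hk).trans hk'.symm)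
  intro φ
  have h := hT.realize_iff hM hN g₁ g₂ (fun i => ⟨v i, i, rfl⟩) φ
  have e₂ : g₂ ∘ (fun i => (⟨v i, i, rfl⟩ : Set.range v)) = w := by
    funext i
    exact hs' _ i rfl
  rw [e₂] at h
  exact h

/-! ### Algebraic closure -/

lemma subset_acl {M : Type} [funLang.Structure M] (X : Set M) : X ⊆ acl funLang X := by
  intro x hx
  refine ⟨{x}, Set.finite_singleton x, ?_, rfl⟩
  rw [Set.Definable₁, Set.definable_iff_exists_formula_sum]
  refine ⟨Term.equal (Term.var (Sum.inr 0)) (Term.var (Sum.inl ⟨x, hx⟩)), ?_⟩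
  ext v
  simp [Formula.realize_equal]

lemma fn_mem_acl {M : Type} [funLang.Structure M] {X : Set M} {x y : M} (hx : x ∈ X)
    (hy : y ∈ X) : fn x y ∈ acl funLang X := by
  refine ⟨{fn x y}, Set.finite_singleton _, ?_, rfl⟩
  rw [Set.Definable₁, Set.definable_iff_exists_formula_sum]
  refine ⟨Term.equal (Term.var (Sum.inr 0))
    (fnTerm (Term.var (Sum.inl ⟨x, hx⟩)) (Term.var (Sum.inl ⟨y, hy⟩))), ?_⟩
  ext v
  simp [Formula.realize_equal]

lemma cst_mem_acl {M : Type} [funLang.Structure M] (X : Set M) : cst M ∈ acl funLang X := by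
  refine ⟨{cst M}, Set.finite_singleton _, ?_, rfl⟩
  rw [Set.Definable₁, Set.definable_iff_exists_formula_sum]
  refine ⟨Term.equal (Term.var (Sum.inr 0)) cstTerm, ?_⟩
  ext v
  simp [Formula.realize_equal]

lemma AclClosed.closedUnder {M : Type} [funLang.Structure M] {X : Set M}
    (hX : AclClosed funLang X) : ClosedUnder X := by
  unfold AclClosed at hX
  constructor
  · have := cst_mem_acl X
    rwa [hX] at this
  · intro x hx y hy
    have := fn_mem_acl hx hy
    rwa [hX] at this

/-- A finite definable set gets no new elements in an elementary extension. -/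
lemma exists_of_realize_of_finite {L : FirstOrder.Language.{0, 0}} {M N κ : Type} [L.Structure M]
    [L.Structure N] (j : M ↪ₑ[L] N) (φ : L.Formula (κ ⊕ Fin 1)) (p : κ → M) {S : Set M}
    (hS : S.Finite) (hφ : ∀ x : M, φ.Realize (Sum.elim p fun _ => x) → x ∈ S) (y : N)
    (hy : φ.Realize (Sum.elim (j ∘ p) fun _ => y)) : ∃ x, j x = y := by
  have : Finite S := hS
  -- The formula `∀ y, φ(p, y) → ⋁ₛ y = s` with parameters `p` and the elements `s` of `S`.
  let θ : L.Formula (κ ⊕ S) := Formula.iAlls (Fin 1) <|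
    (φ.relabel (Sum.map Sum.inl id : κ ⊕ Fin 1 → (κ ⊕ S) ⊕ Fin 1)).imp <|
      Formula.iSup fun s : S => Term.equal (Term.var (Sum.inr 0)) (Term.var (Sum.inl (Sum.inr s)))
  have hθ : ∀ {K : Type} [L.Structure K] (q : κ → K) (r : S → K),
      θ.Realize (Sum.elim q r) ↔
        ∀ z : Fin 1 → K, φ.Realize (Sum.elim q z) → ∃ s, z 0 = r s := by
    intro K _ q r
    have e : ∀ z : Fin 1 → K,
        Sum.elim (Sum.elim q r) z ∘ (Sum.map Sum.inl id : κ ⊕ Fin 1 → (κ ⊕ S) ⊕ Fin 1) =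
          Sum.elim q z := by
      intro z
      funext u
      rcases u with u | u <;> rfl
    simp only [θ, Formula.realize_iAlls, Formula.realize_imp, Formula.realize_relabel, e,
      Formula.realize_iSup, Formula.realize_equal, Term.realize_var, Sum.elim_inr, Sum.elim_inl]
  have hM : θ.Realize (Sum.elim p (Subtype.val : S → M)) := by
    rw [hθ]
    intro z hz
    have hz0 : z = fun _ => z 0 := by
      funext i
      rw [Subsingleton.elim i 0]
    rw [hz0] at hz
    exact ⟨⟨z 0, hφ _ hz⟩, rfl⟩
  rw [← j.map_formula, Sum.comp_elim, hθ] at hM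
  obtain ⟨s, hs⟩ := hM (fun _ => y) hy
  exact ⟨s, hs.symm⟩

/-- In models of a model completion, substructures are algebraically closed: in the free amalgam
of two copies of `M` over `X`, an element of a finite `X`-definable subset of `M` has its second
copy among the elements of the first, hence lies in `X`. -/
lemma IsModelCompletion.aclClosed (hT : IsModelCompletion ∅ T) {M : Type} [funLang.Structure M]
    (hM : M ⊨ T) {X : Set M} (hX : ClosedUnder X) : AclClosed funLang X := by
  refine Set.Subset.antisymm ?_ (subset_acl X)
  rintro x ⟨S, hS, hdef, hx⟩
  rw [Set.Definable₁, Set.definable_iff_exists_formula_sum] at hdef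
  obtain ⟨φ, hφ⟩ := hdef
  have hφ' : ∀ z : M, z ∈ S ↔ φ.Realize (Sum.elim (Subtype.val : X → M) fun _ => z) := by
    intro z
    have := Set.ext_iff.1 hφ (fun _ => z)
    exact this
  let _ := hX.structure
  let g : X ↪[funLang] M :=
    embeddingOf Subtype.val Subtype.val_injective rfl (fun _ _ => rfl)
  obtain ⟨P, _, j, k, hjk, hdisj, -⟩ := exists_free_amalgam g g
  obtain ⟨N, _, hN, ⟨i⟩⟩ := hT.exists_model P
  let j' := hT.toElementary hM hN (i.comp j)
  let k' := hT.toElementary hM hN (i.comp k)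
  have hjk' : j' ∘ (Subtype.val : X → M) = k' ∘ (Subtype.val : X → M) := by
    funext a
    exact congrArg i (hjk a)
  have hk : φ.Realize (Sum.elim (j' ∘ (Subtype.val : X → M)) fun _ => k' x) := by
    have h := (k'.map_formula φ _).2 ((hφ' x).1 hx)
    rw [Sum.comp_elim, ← hjk'] at h
    exact h
  obtain ⟨z, hz⟩ := exists_of_realize_of_finite j' φ _ hS (fun z => (hφ' z).2) _ hk
  obtain ⟨a, -, rfl⟩ := hdisj z x (i.injective hz)
  exact a.2

end ModelCompletion

/-! ### The axioms of free amalgamation -/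

lemma EqType.eq_iff {L : FirstOrder.Language.{0, 0}} {M N ι : Type} [L.Structure M] [L.Structure N]
    {v : ι → M} {w : ι → N} (h : EqType L v w) (i j : ι) : v i = v j ↔ w i = w j := by
  have := h (Term.equal (Term.var i) (Term.var j))
  simpa only [Formula.realize_equal, Term.realize_var] using this

lemma EqType.fn_eq_iff {M N ι : Type} [funLang.Structure M] [funLang.Structure N]
    {v : ι → M} {w : ι → N} (h : EqType funLang v w) (i j k : ι) :
    fn (v i) (v j) = v k ↔ fn (w i) (w j) = w k := by
  have := h (Term.equal (fnTerm (Term.var i) (Term.var j)) (Term.var k))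
  simpa only [Formula.realize_equal, Term.realize_var, realize_fnTerm] using this

lemma EqType.fn_eq_cst_iff {M N ι : Type} [funLang.Structure M] [funLang.Structure N]
    {v : ι → M} {w : ι → N} (h : EqType funLang v w) (i j : ι) :
    fn (v i) (v j) = cst M ↔ fn (w i) (w j) = cst N := by
  have := h (Term.equal (fnTerm (Term.var i) (Term.var j)) cstTerm)
  simpa only [Formula.realize_equal, Term.realize_var, realize_fnTerm, realize_cstTerm] using this

lemma EqType.symm {L : FirstOrder.Language.{0, 0}} {M N ι : Type} [L.Structure M] [L.Structure N]
    {v : ι → M} {w : ι → N} (h : EqType L v w) : EqType L w v := fun φ => (h φ).symm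

lemma EqType.funInd {M N ι : Type} [funLang.Structure M] [funLang.Structure N]
    {v : ι → M} {w : ι → N} (h : EqType funLang v w) {I J K : Set ι}
    (hR : FunInd M (v '' I) (v '' J) (v '' K)) : FunInd N (w '' I) (w '' J) (w '' K) := by
  have hmem : ∀ (i : ι) (K' : Set ι), v i ∈ v '' K' ↔ w i ∈ w '' K' := fun i K' =>
    exists_congr fun k => and_congr_right fun _ => h.eq_iff k i
  constructor
  · rintro _ ⟨⟨i, hi, rfl⟩, hJ⟩
    exact (hmem i K).1 (hR.1 ⟨⟨i, hi, rfl⟩, (hmem i J).2 hJ⟩)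
  · rintro _ ⟨⟨i, hi, rfl⟩, hiK⟩ _ ⟨⟨j, hj, rfl⟩, hjK⟩
    have := hR.2 (v i) ⟨⟨i, hi, rfl⟩, fun hk => hiK ((hmem i K).1 hk)⟩
      (v j) ⟨⟨j, hj, rfl⟩, fun hk => hjK ((hmem j K).1 hk)⟩
    exact ⟨(h.fn_eq_cst_iff i j).1 this.1, (h.fn_eq_cst_iff j i).1 this.2⟩

lemma FunInd.mono {M : Type} [funLang.Structure M] {A B C A₀ B₀ : Set M} (h : FunInd M A B C)
    (hA : A₀ ⊆ A) (hB : B₀ ⊆ B) : FunInd M A₀ B₀ C :=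
  ⟨fun _ hx => h.1 ⟨hA hx.1, hB hx.2⟩,
    fun a ha b hb => h.2 a ⟨hA ha.1, ha.2⟩ b ⟨hB hb.1, hb.2⟩⟩

lemma funInd_iff_of_subset {M : Type} [funLang.Structure M] {A B C D : Set M} (hDC : D ⊆ C)
    (hCB : C ⊆ B) : FunInd M A B D ↔ FunInd M A C D ∧ FunInd M A B C := by
  constructor
  · intro h
    exact ⟨h.mono subset_rfl hCB, h.1.trans hDC,
      fun a ha b hb => h.2 a ⟨ha.1, fun hd => ha.2 (hDC hd)⟩ b ⟨hb.1, fun hd => hb.2 (hDC hd)⟩⟩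
  · rintro ⟨h₁, h₂⟩
    refine ⟨fun x hx => h₁.1 ⟨hx.1, h₂.1 hx⟩, fun a ha b hb => ?_⟩
    by_cases hbC : b ∈ C
    · exact h₁.2 a ha b ⟨hbC, hb.2⟩
    · exact h₂.2 a ⟨ha.1, fun haC => ha.2 (h₁.1 ⟨ha.1, haC⟩)⟩ b ⟨hb.1, hbC⟩

lemma FunInd.freedom {M : Type} [funLang.Structure M] {A B C D : Set M} (h : FunInd M A B C)
    (hCD : C ∩ (A ∪ B) ⊆ D) : FunInd M A B D :=
  ⟨fun _ hx => hCD ⟨h.1 hx, Or.inl hx.1⟩, fun a ha b hb =>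
    h.2 a ⟨ha.1, fun hC => ha.2 (hCD ⟨hC, Or.inl ha.1⟩)⟩
      b ⟨hb.1, fun hC => hb.2 (hCD ⟨hC, Or.inr hb.1⟩)⟩⟩

lemma FunInd.closedUnder_union {M : Type} [funLang.Structure M] {A B C : Set M}
    (h : FunInd M A B C) (hA : ClosedUnder A) (hB : ClosedUnder B) (hC : C ⊆ A ∩ B) :
    ClosedUnder (A ∪ B) := by
  have mixed : ∀ x ∈ A, ∀ y ∈ B, fn x y ∈ A ∪ B ∧ fn y x ∈ A ∪ B := by
    intro x hx y hy
    by_cases hxC : x ∈ C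
    · exact ⟨Or.inr (hB.2 x (hC hxC).2 y hy), Or.inr (hB.2 y hy x (hC hxC).2)⟩
    by_cases hyC : y ∈ C
    · exact ⟨Or.inl (hA.2 x hx y (hC hyC).1), Or.inl (hA.2 y (hC hyC).1 x hx)⟩
    obtain ⟨h₁, h₂⟩ := h.2 x ⟨hx, hxC⟩ y ⟨hy, hyC⟩
    rw [h₁, h₂]
    exact ⟨Or.inl hA.1, Or.inl hA.1⟩
  refine ⟨Or.inl hA.1, ?_⟩
  rintro x (hx | hx) y (hy | hy)
  · exact Or.inl (hA.2 x hx y hy)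
  · exact (mixed x hx y hy).1
  · exact (mixed y hy x hx).2
  · exact Or.inr (hB.2 x hx y hy)

section Axioms

variable {T : funLang.Theory}

/-- Full existence: realize the type of `a` over `C` by the second copy of `a` in the free amalgam
of two copies of `M` over `C`. -/
lemma IsModelCompletion.fullExistence (hT : IsModelCompletion ∅ T) {M : Type}
    [funLang.Structure M] (hM : M ⊨ T) {ι : Type} (a : ι → M) (B : Set M) {C : Set M}
    (hC : ClosedUnder C) :
    ∃ (N : Type) (_ : funLang.Structure N) (j : M ↪ₑ[funLang] N) (a' : ι → N),
      EqTypeOver funLang (j '' C) a' (fun i => j (a i)) ∧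
        FunInd N (Set.range a') (j '' B) (j '' C) := by
  let _ := hC.structure
  let g : C ↪[funLang] M :=
    embeddingOf Subtype.val Subtype.val_injective rfl (fun _ _ => rfl)
  have hg : ∀ x, x ∉ C → x ∉ Set.range g := by
    rintro x hx ⟨y, rfl⟩
    exact hx y.2
  obtain ⟨P, _, j, k, hjk, hdisj, hfree⟩ := exists_free_amalgam g g
  obtain ⟨N, _, hN, ⟨i⟩⟩ := hT.exists_model P
  let j' := hT.toElementary hM hN (i.comp j)
  let k' := hT.toElementary hM hN (i.comp k)
  have hjk' : ∀ x ∈ C, k' x = j' x := fun x hx => congrArg i (hjk ⟨x, hx⟩).symm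
  refine ⟨N, inferInstance, j', k' ∘ a, ?_, ?_, ?_⟩
  · intro φ
    choose s hsC hs using fun y : (j' '' C : Set N) => y.2
    have e₁ : Sum.elim (k' ∘ a) (fun y : (j' '' C : Set N) => (y : N)) = k' ∘ Sum.elim a s := by
      rw [Sum.comp_elim]
      congr 1
      funext y
      exact (hs y).symm.trans (hjk' _ (hsC y)).symm
    have e₂ : Sum.elim (fun i => j' (a i)) (fun y : (j' '' C : Set N) => (y : N)) =
        j' ∘ Sum.elim a s := by
      rw [Sum.comp_elim]
      congr 1
      funext y
      exact (hs y).symm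
    rw [e₁, e₂, k'.map_formula, j'.map_formula]
  · rintro _ ⟨⟨l, rfl⟩, ⟨b, -, hb⟩⟩
    obtain ⟨x, rfl, hx⟩ := hdisj b (a l) (i.injective hb)
    exact ⟨x, x.2, hb⟩
  · rintro _ ⟨⟨l, rfl⟩, hl⟩ _ ⟨⟨b, -, rfl⟩, hbC⟩
    have hl' : a l ∉ C := fun h => hl ⟨a l, h, (hjk' _ h).symm⟩
    have hb' : b ∉ C := fun h => hbC ⟨b, h, rfl⟩
    obtain ⟨h₁, h₂⟩ := hfree b (hg b hb') (a l) (hg _ hl')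
    rw [← map_cst i]
    constructor
    · rw [← h₂]
      exact (map_fn i _ _).symm
    · rw [← h₁]
      exact (map_fn i _ _).symm

/-- Stationarity: independence over `C` determines `f` between `a` and `b`, so that `a ↦ a'`
extends by the identity of `b` to an isomorphism of substructures. -/
lemma IsModelCompletion.stationarity (hT : IsModelCompletion ∅ T) {M : Type}
    [funLang.Structure M] (hM : M ⊨ T) {ι : Type} (a a' : ι → M) {b C : Set M}
    (ha : ClosedUnder (Set.range a)) (hb : ClosedUnder b) (hC : C ⊆ Set.range a ∩ b)
    (h : EqTypeOver funLang C a' a) (hR : FunInd M (Set.range a) b C)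
    (hR' : FunInd M (Set.range a') b C) : EqTypeOver funLang b a' a := by
  have hmem : ∀ i x, x ∈ C → (a i = x ↔ a' i = x) := fun i x hx =>
    (EqType.eq_iff h (Sum.inl i) (Sum.inr ⟨x, hx⟩)).symm
  have heq : ∀ i x, x ∈ b → (a i = x ↔ a' i = x) := by
    intro i x hx
    constructor
    · intro hi
      exact (hmem i x (hR.1 ⟨⟨i, hi⟩, hx⟩)).1 hi
    · intro hi
      exact (hmem i x (hR'.1 ⟨⟨i, hi⟩, hx⟩)).2 hi
  have mixed : ∀ (i : ι) (y : b), ∃ k k' : ι ⊕ b,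
      (fn (a i) y = Sum.elim a (fun x : b => (x : M)) k ∧
        fn (a' i) y = Sum.elim a' (fun x : b => (x : M)) k) ∧
      (fn (y : M) (a i) = Sum.elim a (fun x : b => (x : M)) k' ∧
        fn (y : M) (a' i) = Sum.elim a' (fun x : b => (x : M)) k') := by
    rintro i ⟨y, hy⟩
    by_cases hi : a i ∈ C
    · have hi' : a' i = a i := (hmem i _ hi).1 rfl
      rw [hi']
      exact ⟨Sum.inr ⟨_, hb.2 _ (hC hi).2 y hy⟩, Sum.inr ⟨_, hb.2 y hy _ (hC hi).2⟩,
        ⟨rfl, rfl⟩, rfl, rfl⟩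
    by_cases hyC : y ∈ C
    · obtain ⟨l, rfl⟩ := (hC hyC).1
      have hl' : a' l = a l := (hmem l _ hyC).1 rfl
      obtain ⟨k, hk⟩ := ha.2 (a i) ⟨i, rfl⟩ (a l) ⟨l, rfl⟩
      obtain ⟨k', hk'⟩ := ha.2 (a l) ⟨l, rfl⟩ (a i) ⟨i, rfl⟩
      refine ⟨Sum.inl k, Sum.inl k', ⟨hk.symm, ?_⟩, hk'.symm, ?_⟩
      · have := (EqType.fn_eq_iff h (Sum.inl i) (Sum.inl l) (Sum.inl k)).2 hk.symm
        simpa [hl'] using this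
      · have := (EqType.fn_eq_iff h (Sum.inl l) (Sum.inl i) (Sum.inl k')).2 hk'.symm
        simpa [hl'] using this
    · have hi' : a' i ∉ C := fun hc => hi (by
        rwa [(hmem i (a' i) hc).2 rfl])
      obtain ⟨h₁, h₂⟩ := hR.2 _ ⟨⟨i, rfl⟩, hi⟩ y ⟨hy, hyC⟩
      obtain ⟨h₁', h₂'⟩ := hR'.2 _ ⟨⟨i, rfl⟩, hi'⟩ y ⟨hy, hyC⟩
      exact ⟨Sum.inr ⟨_, hb.1⟩, Sum.inr ⟨_, hb.1⟩, ⟨h₁, h₁'⟩, h₂, h₂'⟩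
  refine EqType.symm (hT.eqType hM hM _ _ ?_ ?_ ?_)
  · rintro (i | ⟨x, hx⟩) (j | ⟨y, hy⟩)
    · exact (EqType.eq_iff h (Sum.inl i) (Sum.inl j)).symm
    · exact heq i y hy
    · exact eq_comm.trans ((heq j x hx).trans eq_comm)
    · exact Iff.rfl
  · exact ⟨Sum.inr ⟨_, hb.1⟩, rfl, rfl⟩
  · rintro (i | x) (j | y)
    · obtain ⟨k, hk⟩ := ha.2 (a i) ⟨i, rfl⟩ (a j) ⟨j, rfl⟩
      exact ⟨Sum.inl k, hk.symm,
        (EqType.fn_eq_iff h (Sum.inl i) (Sum.inl j) (Sum.inl k)).2 hk.symm⟩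
    · obtain ⟨k, -, hk, -⟩ := mixed i y
      exact ⟨k, hk⟩
    · obtain ⟨-, k, -, hk⟩ := mixed j x
      exact ⟨k, hk⟩
    · exact ⟨Sum.inr ⟨_, hb.2 x x.2 y y.2⟩, rfl, rfl⟩

/-- `FunInd` is a free amalgamation relation for every theory all of whose models are models of a
model completion of the empty theory. -/
lemma IsModelCompletion.isFreeAmalgamationRelation (hT : IsModelCompletion ∅ T)
    {T' : funLang.Theory}
    (hT' : ∀ (M : Type) [funLang.Structure M] [Nonempty M], M ⊨ T' → M ⊨ T) :
    IsFreeAmalgamationRelation T' FunInd where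
  invariance _ _ _ _ _ _ _ _ _ _ _ h _ _ _ := ⟨h.funInd, h.symm.funInd⟩
  monotonicity _ _ _ _ _ _ _ _ _ h hA hB := h.mono hA hB
  fullTransitivity _ _ _ _ _ _ _ _ hDC hCB := funInd_iff_of_subset hDC hCB
  fullExistence M _ _ hM _ a B _ hC := hT.fullExistence (hT' M hM) a B hC.closedUnder
  stationarity M _ _ hM _ a a' _ _ ha hb _ hC h hR hR' :=
    hT.stationarity (hT' M hM) a a' ha.closedUnder hb.closedUnder hC h hR hR'
  freedom _ _ _ _ _ _ _ _ h hCD _ := h.freedom hCD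
  closure M _ _ hM _ _ _ ha hb _ hC hR :=
    hT.aclClosed (hT' M hM) (hR.closedUnder_union ha.closedUnder hb.closedUnder hC)

end Axioms

/-! ### Failure of modularity -/

/-- The image of an elementary embedding, as an elementary substructure. -/
def elementaryRange {L : FirstOrder.Language.{0, 0}} {M N : Type} [L.Structure M] [L.Structure N]
    (j : M ↪ₑ[L] N) : L.ElementarySubstructure N where
  toSubstructure := j.toHom.range
  isElementary' := by
    intro n φ x
    choose s hs using fun i => (x i).2
    let j' : M ≃[L] j.toHom.range := j.toEmbedding.equivRange
    have e : x = j' ∘ s := by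
      funext i
      exact Subtype.ext (hs i).symm
    have e' : ((↑) : j.toHom.range → N) ∘ x = j ∘ s := by
      funext i
      exact (hs i).symm
    rw [e', j.map_formula, e]
    exact (StrongHomClass.realize_formula j' φ).symm

lemma exists_one_point_extension (M : Type) [funLang.Structure M] :
    ∃ (P : Type) (_ : funLang.Structure P) (i : M ↪[funLang] P) (d : P), d ∉ Set.range i := by
  let _ : funLang.Structure (Option M) := structureOf
    (fun p q => match p, q with
      | some x, some y => some (fn x y)
      | _, _ => none) (some (cst M))
  refine ⟨Option M, inferInstance,
    embeddingOf some (Option.some_injective M) rfl (fun _ _ => rfl), none, ?_⟩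
  rintro ⟨x, hx⟩
  cases hx

/-- Every structure `D` with a distinguished element `d` has an extension by two new elements `a`
and `e` with `f(a, d) = e`, all other values of `f` involving `a` or `e` being `c`. -/
lemma exists_two_point_extension {D : Type} [funLang.Structure D] (d : D) :
    ∃ (P : Type) (_ : funLang.Structure P) (i : D ↪[funLang] P) (a e : P),
      a ∉ Set.range i ∧ e ∉ Set.range i ∧ a ≠ e ∧ fn a (i d) = e ∧
      (∀ x, x ≠ d → fn a (i x) = cst P) ∧ (∀ x, fn (i x) a = cst P) ∧ fn a a = cst P ∧
      (∀ x, fn (i x) e = cst P) ∧ (∀ x, fn e (i x) = cst P) ∧ fn e e = cst P := by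
  classical
  let _ : funLang.Structure (D ⊕ Bool) := structureOf
    (fun p q => match p, q with
      | Sum.inl x, Sum.inl y => Sum.inl (fn x y)
      | Sum.inr true, Sum.inl y => if y = d then Sum.inr false else Sum.inl (cst D)
      | _, _ => Sum.inl (cst D)) (Sum.inl (cst D))
  refine ⟨D ⊕ Bool, inferInstance, embeddingOf Sum.inl Sum.inl_injective rfl (fun _ _ => rfl),
    Sum.inr true, Sum.inr false, ?_, ?_, ?_, if_pos rfl, fun x hx => if_neg hx,
    fun _ => rfl, rfl, fun _ => rfl, fun _ => rfl, rfl⟩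
  · rintro ⟨x, hx⟩
    cases hx
  · rintro ⟨x, hx⟩
    cases hx
  · intro h
    cases h

/-- Over models `B ⊆ D` with `d ∈ D \ B`, take `a` and `e` outside `D` with `f(a, d) = e`, all
other new values of `f` being `c`. Then `a` is algebraically independent from `C = D ∪ {e}` over
`B`, but not over `D`, as `e` lies in the algebraic closure of `D ∪ {a}`. -/
lemma IsModelCompletion.not_isModularOverModels {T T' : funLang.Theory}
    (hT : IsModelCompletion ∅ T)
    (hT' : ∀ (M : Type) [funLang.Structure M] [Nonempty M], M ⊨ T' → M ⊨ T)
    (hsat : T'.IsSatisfiable) : ¬ IsModularOverModels T' := by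
  intro hmod
  obtain ⟨⟨M⟩⟩ := hsat
  have hM : M ⊨ T := hT' M inferInstance
  obtain ⟨P₁, _, i₁, d₁, hd₁⟩ := exists_one_point_extension M
  obtain ⟨D, _, hD, ⟨k₁⟩⟩ := hT.exists_model P₁
  obtain ⟨P₂, _, i₂, a₂, e₂, ha₂, he₂, hae, had, hax, hxa, haa, hxe, hex, hee⟩ :=
    exists_two_point_extension (k₁ d₁)
  obtain ⟨N, _, hN, ⟨k₂⟩⟩ := hT.exists_model P₂
  have hdM : ∀ x, k₁ (i₁ x) ≠ k₁ d₁ := fun x hx => hd₁ ⟨x, k₁.injective hx⟩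
  let jD : D ↪ₑ[funLang] N := hT.toElementary hD hN (k₂.comp i₂)
  let jM : M ↪ₑ[funLang] D := hT.toElementary hM hD (k₁.comp i₁)
  let jB : M ↪ₑ[funLang] N := jD.comp jM
  have hjD : ∀ x, jD x = k₂ (i₂ x) := fun _ => rfl
  have hjB : ∀ x, jB x = k₂ (i₂ (k₁ (i₁ x))) := fun _ => rfl
  have hN' : N ⊨ T' := (jB.theory_model_iff T').1 inferInstance
  have : Nonempty N := ⟨cst N⟩
  let B := elementaryRange jB
  let D' := elementaryRange jD
  let A : Set N := {k₂ a₂}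
  let C : Set N := insert (k₂ e₂) (D' : Set N)
  have hBD : (B : Set N) ⊆ D' := by
    rintro _ ⟨x, rfl⟩
    exact ⟨jM x, rfl⟩
  have hDC : (D' : Set N) ⊆ C := Set.subset_insert _ _
  have hBcl : ClosedUnder (B : Set N) := closedUnder_range jB.toEmbedding
  have hDcl : ClosedUnder (D' : Set N) := closedUnder_range jD.toEmbedding
  have hc : k₂ (cst P₂) = cst N := map_cst k₂
  have hABcl : ClosedUnder (A ∪ B) := by
    refine ⟨Or.inr hBcl.1, ?_⟩
    rintro x (rfl | hx) y (rfl | hy)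
    · rw [← map_fn, haa, hc]
      exact Or.inr hBcl.1
    · obtain ⟨y, rfl⟩ := hy
      have : fn (k₂ a₂) (jB y) = cst N := by rw [hjB, ← map_fn, hax _ (hdM y), hc]
      exact Or.inr (this ▸ hBcl.1)
    · obtain ⟨x, rfl⟩ := hx
      have : fn (jB x) (k₂ a₂) = cst N := by rw [hjB, ← map_fn, hxa, hc]
      exact Or.inr (this ▸ hBcl.1)
    · exact Or.inr (hBcl.2 x hx y hy)
  have hCcl : ClosedUnder C := by
    refine ⟨hDC hDcl.1, ?_⟩
    rintro x (rfl | hx) y (rfl | hy)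
    · rw [← map_fn, hee, hc]
      exact hDC hDcl.1
    · obtain ⟨y, rfl⟩ := hy
      have : fn (k₂ e₂) (jD y) = cst N := by rw [hjD, ← map_fn, hex, hc]
      exact hDC (this ▸ hDcl.1)
    · obtain ⟨x, rfl⟩ := hx
      have : fn (jD x) (k₂ e₂) = cst N := by rw [hjD, ← map_fn, hxe, hc]
      exact hDC (this ▸ hDcl.1)
    · exact hDC (hDcl.2 x hx y hy)
  have hacl : ∀ {X : Set N}, ClosedUnder X → acl funLang X = X := fun hX => hT.aclClosed hN hX
  have hind : AlgInd funLang N A C B := by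
    unfold AlgInd
    rw [Set.union_eq_left.2 (hBD.trans hDC), hacl hABcl, hacl hCcl, hacl hBcl]
    refine Set.Subset.antisymm ?_ fun x hx => ⟨Or.inr hx, hDC (hBD hx)⟩
    rintro x ⟨rfl | hx, hxC⟩
    · exfalso
      rcases hxC with h | ⟨y, hy⟩
      · exact hae (k₂.injective h)
      · exact ha₂ ⟨y, k₂.injective hy⟩
    · exact hx
  have hbad := hmod N hN' A C B D' hind hBD hDC
  unfold AlgInd at hbad
  rw [hacl hDcl] at hbad
  have he : k₂ e₂ ∈ (D' : Set N) := by
    rw [← hbad]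
    constructor
    · have hf : fn (k₂ a₂) (jD (k₁ d₁)) = k₂ e₂ := by rw [hjD, ← map_fn, had]
      rw [← hf]
      exact fn_mem_acl (Or.inl rfl) (Or.inr ⟨_, rfl⟩)
    · exact subset_acl _ (Or.inl (Or.inl rfl))
  obtain ⟨y, hy⟩ := he
  exact he₂ ⟨y, k₂.injective hy⟩

lemma IsModular.isModularOverModels {L : FirstOrder.Language.{0, 0}} {T : L.Theory} (h : IsModular T) :
    IsModularOverModels T :=
  fun M _ _ hM A C B D hAC hBD hDC => h M hM A B C D hAC hBD hDC

/-- The completions of a model completion of the empty theory are non-modular free amalgamation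
theories. -/
lemma IsModelCompletion.completion {T T' : funLang.Theory} (hT : IsModelCompletion ∅ T)
    (hc : T'.IsComplete) (hTT' : ∀ φ ∈ T, Theory.ModelsBoundedFormula T' φ) :
    IsFreeAmalgamationRelation T' FunInd ∧ IsFreeAmalgamationTheory T' ∧
      ¬ IsModular T' ∧ ¬ IsModularOverModels T' := by
  have hT' : ∀ (M : Type) [funLang.Structure M] [Nonempty M], M ⊨ T' → M ⊨ T := by
    intro M _ _ hM
    rw [Theory.model_iff]
    exact fun φ hφ => (hTT' φ hφ).realize_sentence M
  have hR := hT.isFreeAmalgamationRelation hT'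
  have hmod := hT.not_isModularOverModels hT' hc.1
  exact ⟨hR, ⟨hc, FunInd, hR⟩, fun h => hmod h.isModularOverModels, hmod⟩

end FreeAmalg

theorem mainTheorem4 :
    (∃ T : FreeAmalg.funLang.Theory, FreeAmalg.IsModelCompletion ∅ T) ∧
    (∀ T : FreeAmalg.funLang.Theory, FreeAmalg.IsModelCompletion ∅ T →
      FreeAmalg.IsFreeAmalgamationRelation T FreeAmalg.FunInd ∧
      ∀ T' : FreeAmalg.funLang.Theory, T'.IsComplete → (∀ φ ∈ T, FirstOrder.Language.Theory.ModelsBoundedFormula T' φ) →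
        FreeAmalg.IsFreeAmalgamationRelation T' FreeAmalg.FunInd ∧
        FreeAmalg.IsFreeAmalgamationTheory T' ∧
        ¬ FreeAmalg.IsModular T' ∧
        ¬ FreeAmalg.IsModularOverModels T') ∧
    (∃ T' : FreeAmalg.funLang.Theory,
      FreeAmalg.IsFreeAmalgamationTheory T' ∧
      ¬ FreeAmalg.IsModular T' ∧
      ¬ FreeAmalg.IsModularOverModels T') := by
  refine ⟨⟨FreeAmalg.extTheory, FreeAmalg.isModelCompletion_extTheory⟩, fun T hT =>
    ⟨hT.isFreeAmalgamationRelation fun _ _ _ h => h, fun T' hc hTT' => hT.completion hc hTT'⟩, ?_⟩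
  let _ : FreeAmalg.funLang.Structure Unit := FreeAmalg.structureOf (fun _ _ => ()) ()
  obtain ⟨M, _, hM, -⟩ := FreeAmalg.isModelCompletion_extTheory.exists_model Unit
  have : Nonempty M := ⟨FreeAmalg.cst M⟩
  have hc := FirstOrder.Language.completeTheory.isComplete FreeAmalg.funLang M
  exact ⟨FreeAmalg.funLang.completeTheory M, (FreeAmalg.isModelCompletion_extTheory.completion hc
    fun φ hφ => FirstOrder.Language.Theory.models_sentence_of_mem
      (FirstOrder.Language.Theory.realize_sentence_of_mem FreeAmalg.extTheory hφ)).2⟩
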